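/- Let $G$ be a finite, loopless, undirected, connected multigraph with vertex set $V(G)$ and edge set $E(G)$, and let $g=|E(G)|-|V(G)|+1$. A divisor is a function $D:V(G)\to\mathbb Z$; its degree is $\deg(D)=\sum_v D(v)$, and $D$ is effective, written $D\ge 0$, if $D(v)\ge 0$ for all $v$. Two divisors $D,D'$ are linearly equivalent, $D\sim D'$, if $D-D'$ lies in the $\mathbb Z$-span of the columns of the Laplacian of $G$ (the diagonal matrix of vertex degrees minus the adjacency matrix, counted with multiplicity). The rank $r(D)$ is one less than the minimum of $\deg(E)$ over all divisors $E\ge 0$ such that $D-E$ is not linearly equivalent to an effective divisor. A partial orientation $\mathcal O$ of $G$ is an orientation of a subset of the edges; its associated divisor $D_{\mathcal O}$ is given by $D_{\mathcal O}(v)=\mathrm{indeg}_{\mathcal O}(v)-1$, where $\mathrm{indeg}_{\mathcal O}(v)$ is the number of edges oriented towards $v$. For $q\in V(G)$, $\mathcal O$ is $q$-connected if there is a directed path in $\mathcal O$ from $q$ to every other vertex, and $(q)$ denotes the divisor with value $1$ at $q$ and $0$ elsewhere. Theorem. Let $q\in V(G)$ and let $D$ be a divisor on $G$ with $\deg(D)\le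 g-1$. Then there is a $q$-connected partial orientation $\mathcal O$ of $G$ with $D\sim D_{\mathcal O}$ if and only if $r(D+(q))\ge 0$. -/

import Mathlib

namespace Graph

variable {α β : Type*}

/-- A multigraph is connected if it has a vertex and any two vertices are joined by a walk. -/
def IsConnectedGraph (G : Graph α β) : Prop :=
  G.vertexSet.Nonempty ∧
    ∀ u ∈ G.vertexSet, ∀ v ∈ G.vertexSet, Relation.ReflTransGen G.Adj u v

/-- A divisor: an integer-valued function on the vertices. -/
abbrev Divisor (G : Graph α β) : Type _ := G.vertexSet → ℤ

/-- The net number of chips of a divisor. -/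
def divDegree (G : Graph α β) [Fintype G.vertexSet] (D : G.Divisor) : ℤ := ∑ v, D v

open Classical in
/-- The divisor `(q)`: a single chip at `q`. -/
noncomputable def chip (G : Graph α β) (q : G.vertexSet) : G.Divisor := Pi.single q 1

/-- The genus `|E(G)| - |V(G)| + 1`, an integer. -/
noncomputable def genus (G : Graph α β) : ℤ :=
  (Nat.card G.edgeSet : ℤ) - (Nat.card G.vertexSet : ℤ) + 1

/-- The number of edges incident to `v`. -/
noncomputable def vertexDegree (G : Graph α β) (v : G.vertexSet) : ℕ :=
  Nat.card {e : G.edgeSet // G.Inc (e : β) (v : α)}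

/-- The number of edges with ends `u` and `v`. -/
noncomputable def edgeCount (G : Graph α β) (u v : G.vertexSet) : ℕ :=
  Nat.card {e : G.edgeSet // G.IsLink (e : β) (u : α) (v : α)}

open Classical in
/-- The Laplacian: the diagonal degree matrix minus the adjacency matrix. -/
noncomputable def laplacian (G : Graph α β) : Matrix G.vertexSet G.vertexSet ℤ :=
  Matrix.diagonal (fun v => (G.vertexDegree v : ℤ)) -
    Matrix.of (fun u v => (G.edgeCount u v : ℤ))

/-- `D` and `D'` are linearly equivalent if `D - D'` is an integer combination of the columns of
the Laplacian. -/
def LinearlyEquivalent (G : Graph α β) [Fintype G.vertexSet] (D D' : G.Divisor) : Prop :=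
  ∃ f : G.vertexSet → ℤ, D - D' = G.laplacian.mulVec f

/-- The Baker-Norine rank: one less than the least degree of an effective divisor `E` such that
`D - E` is not linearly equivalent to an effective divisor. The set of such degrees is nonempty
whenever `G` has a vertex (see `rank_set_nonempty`), so the infimum is a minimum. -/
noncomputable def divRank (G : Graph α β) [Fintype G.vertexSet] (D : G.Divisor) : ℤ :=
  (sInf {k : ℕ | ∃ E : G.Divisor, 0 ≤ E ∧ G.divDegree E = k ∧
    ¬ ∃ E' : G.Divisor, 0 ≤ E' ∧ G.LinearlyEquivalent (D - E) E'} : ℕ) - 1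

/-- A partial orientation: some edges are given a head, which is one of their ends; the edges `e`
with `head e = none` are unoriented. -/
structure PartialOrientation (G : Graph α β) where
  /-- The head of an edge, if the edge is oriented. -/
  head : G.edgeSet → Option G.vertexSet
  /-- The head of an oriented edge is one of its ends. -/
  inc_head : ∀ e v, head e = some v → G.Inc (e : β) (v : α)

namespace PartialOrientation

variable {G : Graph α β}

/-- The number of edges oriented towards `v`. -/
noncomputable def indeg (O : G.PartialOrientation) (v : G.vertexSet) : ℕ :=
  Nat.card {e : G.edgeSet // O.head e = some v}

/-- The divisor of a partial orientation, `v ↦ indeg v - 1`. -/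
noncomputable def divisor (O : G.PartialOrientation) : G.Divisor :=
  fun v => (O.indeg v : ℤ) - 1

/-- Some edge with ends `u` and `v` is oriented with tail `u` and head `v`. -/
def Arc (O : G.PartialOrientation) (u v : G.vertexSet) : Prop :=
  ∃ e : G.edgeSet, G.IsLink (e : β) (u : α) (v : α) ∧ O.head e = some v

/-- Every vertex is reached from `q` by a directed path. -/
def IsQConnected (O : G.PartialOrientation) (q : G.vertexSet) : Prop :=
  ∀ v, Relation.ReflTransGen O.Arc q v

end PartialOrientation

end Graph

namespace Graph
variable {α β : Type*}
theorem vertexDegree_eq_sum (G : Graph α β) [G.Loopless] [Fintype G.vertexSet]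
    [Finite G.edgeSet] (v : G.vertexSet) : G.vertexDegree v = ∑ u, G.edgeCount u v := by
  classical
  have := Fintype.ofFinite G.edgeSet
  unfold vertexDegree edgeCount
  rw [← Nat.card_sigma]
  refine Nat.card_congr ⟨fun e => ⟨⟨e.2.other, e.2.isLink_other.right_mem⟩, e.1,
    e.2.isLink_other.symm⟩, fun x => ⟨x.2.1, x.2.2.inc_right⟩, fun e => rfl, ?_⟩
  rintro ⟨⟨u, hu⟩, e, he⟩
  have hi : G.Inc (e : β) (v : α) := he.inc_right
  have : hi.other = u := hi.isLink_other.right_unique he.symm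
  subst this
  rfl

theorem sum_laplacian_mulVec (G : Graph α β) [G.Loopless] [Fintype G.vertexSet]
    [Finite G.edgeSet] (f : G.vertexSet → ℤ) : ∑ v, G.laplacian.mulVec f v = 0 := by
  classical
  simp only [Matrix.mulVec, dotProduct]
  rw [Finset.sum_comm]
  refine Finset.sum_eq_zero fun v _ => ?_
  rw [← Finset.sum_mul]
  convert zero_mul _
  simp [laplacian, Matrix.diagonal_apply, vertexDegree_eq_sum]

/-- The set in the definition of the rank is nonempty when `G` has a vertex. -/
theorem rank_set_nonempty (G : Graph α β) [G.Loopless] [Fintype G.vertexSet]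
    [Finite G.edgeSet] (q : G.vertexSet) (D : G.Divisor) :
    {k : ℕ | ∃ E : G.Divisor, 0 ≤ E ∧ G.divDegree E = k ∧
      ¬ ∃ E' : G.Divisor, 0 ≤ E' ∧ G.LinearlyEquivalent (D - E) E'}.Nonempty := by
  classical
  refine ⟨(G.divDegree D).toNat + 1, ((G.divDegree D).toNat + 1 : ℤ) • G.chip q, ?_, ?_, ?_⟩
  · exact smul_nonneg (by positivity) (by simp [chip])
  · simp [divDegree, chip, ← Finset.mul_sum]
  · rintro ⟨E', hE', f, hf⟩
    have h := congrArg (fun D : G.Divisor => ∑ v, D v) hf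
    have h0 : 0 ≤ ∑ v, E' v := Finset.sum_nonneg fun v _ => hE' v
    simp [sum_laplacian_mulVec, chip, ← Finset.mul_sum, divDegree] at h
    have := Int.self_le_toNat (∑ v, D v)
    omega
end Graph

/-! In a `q`-connected partial orientation every vertex other than `q` has an incoming edge, so
adding a chip at `q` to its divisor gives an effective divisor. Conversely, if `D + (q) ~ E ≥ 0`,
then `F = E - (q) + 1` is effective and positive off `q`, and the bound on `deg D` says `deg F ≤
|E(G)|`. Two moves keep the divisor class: an edge pivot fixes all indegrees, and reversing a fully
oriented cut fires one side of it. With them the chips of `F` become incoming edges one at a time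
(`exists_linearlyEquivalent_divisor_of_nonneg`), and the result is then made `q`-connected
(`exists_isQConnected_linearlyEquivalent`). Both terminate because cut reversals, and in the second
also pivots, enlarge a reachable set. -/

namespace Graph

variable {α β : Type*} {G : Graph α β}

/-! ### Linear equivalence, rank and the Laplacian. -/

section LinearEquivalence

variable [Fintype G.vertexSet]

theorem LinearlyEquivalent.refl (D : G.Divisor) : G.LinearlyEquivalent D D :=
  ⟨0, by simp⟩

theorem LinearlyEquivalent.trans {D D' D'' : G.Divisor} (h : G.LinearlyEquivalent D D')
    (h' : G.LinearlyEquivalent D' D'') : G.LinearlyEquivalent D D'' := by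
  obtain ⟨f, hf⟩ := h
  obtain ⟨g, hg⟩ := h'
  exact ⟨f + g, by rw [Matrix.mulVec_add, ← hf, ← hg, sub_add_sub_cancel]⟩

theorem LinearlyEquivalent.add_right {D D' : G.Divisor} (h : G.LinearlyEquivalent D D')
    (F : G.Divisor) : G.LinearlyEquivalent (D + F) (D' + F) := by
  obtain ⟨f, hf⟩ := h
  exact ⟨f, by rw [← hf, add_sub_add_right_eq_sub]⟩

theorem LinearlyEquivalent.divDegree_eq [G.Loopless] [Finite G.edgeSet] {D D' : G.Divisor}
    (h : G.LinearlyEquivalent D D') : G.divDegree D = G.divDegree D' := by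
  obtain ⟨f, hf⟩ := h
  have h := G.sum_laplacian_mulVec f
  rw [← hf] at h
  simp only [Pi.sub_apply, Finset.sum_sub_distrib] at h
  exact sub_eq_zero.1 h

theorem divDegree_add (D D' : G.Divisor) :
    G.divDegree (D + D') = G.divDegree D + G.divDegree D' := by
  simp [divDegree, Finset.sum_add_distrib]

theorem divDegree_chip (v : G.vertexSet) : G.divDegree (G.chip v) = 1 := by
  classical
  simp [divDegree, chip]

/-- Only `E = 0` is effective of degree zero. Nonemptiness excludes the default value `sInf ∅ = 0`.
-/
theorem divRank_nonneg_iff [G.Loopless] [Finite G.edgeSet] (q : G.vertexSet) (D : G.Divisor) :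
    0 ≤ G.divRank D ↔ ∃ E : G.Divisor, 0 ≤ E ∧ G.LinearlyEquivalent D E := by
  have hne := G.rank_set_nonempty q D
  rw [divRank, sub_nonneg, Nat.one_le_cast, Nat.one_le_iff_ne_zero, ne_eq, Nat.sInf_eq_zero,
    or_iff_left hne.ne_empty]
  constructor
  · intro h
    by_contra hE
    exact h ⟨0, le_rfl, by simp [divDegree], by simpa using hE⟩
  · rintro ⟨E, hE, hDE⟩ ⟨F, hF, hF0, h⟩
    have : F = 0 := by
      funext v
      exact (Finset.sum_eq_zero_iff_of_nonneg fun v _ => hF v).1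
        (by simpa [divDegree] using hF0) v (Finset.mem_univ v)
    subst this
    exact h ⟨E, hE, by simpa using hDE⟩

theorem laplacian_mulVec_apply [G.Loopless] [Finite G.edgeSet] (f : G.vertexSet → ℤ)
    (v : G.vertexSet) :
    G.laplacian.mulVec f v = ∑ u, (G.edgeCount u v : ℤ) * (f v - f u) := by
  classical
  have hc : ∀ u, G.edgeCount v u = G.edgeCount u v := fun u =>
    Nat.card_congr (Equiv.subtypeEquivRight fun e => G.isLink_comm)
  simp only [laplacian, Matrix.sub_mulVec, Matrix.mulVec_diagonal, Pi.sub_apply, mul_sub,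
    Finset.sum_sub_distrib, ← Finset.sum_mul]
  rw [vertexDegree_eq_sum]
  simp [Matrix.mulVec, dotProduct, hc]

end LinearEquivalence

/-- In a connected multigraph every set of vertices that is neither empty nor everything has an
edge on its boundary. -/
theorem IsConnectedGraph.exists_isLink_of_mem_of_notMem (hG : G.IsConnectedGraph)
    {R : Set G.vertexSet} {r x : G.vertexSet} (hr : r ∈ R) (hx : x ∉ R) :
    ∃ (e : G.edgeSet) (u v : G.vertexSet), G.IsLink (e : β) (u : α) (v : α) ∧ u ∈ R ∧ v ∉ R := by
  by_contra! h
  have key : ∀ y, Relation.ReflTransGen G.Adj (r : α) y → ∀ hy : y ∈ G.vertexSet,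
      (⟨y, hy⟩ : G.vertexSet) ∈ R := by
    intro y hry
    induction hry with
    | refl => exact fun _ => hr
    | tail _ hyz ih =>
      intro hz
      obtain ⟨e, he⟩ := hyz
      exact h ⟨e, he.edge_mem⟩ ⟨_, he.left_mem⟩ ⟨_, hz⟩ he (ih he.left_mem)
  exact hx (key x (hG.2 r r.2 x x.2) x.2)

/-! ### Edge pivots and directed walks. -/

namespace PartialOrientation

open Classical in
/-- Reorient, orient or unorient a single edge. -/
noncomputable def update (O : G.PartialOrientation) (e : G.edgeSet) (o : Option G.vertexSet)
    (h : ∀ v, o = some v → G.Inc (e : β) (v : α)) : G.PartialOrientation where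
  head := Function.update O.head e o
  inc_head e' v hv := by
    by_cases he : e' = e
    · subst he
      exact h v (by simpa using hv)
    · exact O.inc_head e' v (by simpa [he] using hv)

theorem head_update_self (O : G.PartialOrientation) (e : G.edgeSet) (o : Option G.vertexSet)
    (h : ∀ v, o = some v → G.Inc (e : β) (v : α)) : (O.update e o h).head e = o := by
  simp [update]

theorem head_update_of_ne (O : G.PartialOrientation) {e e' : G.edgeSet} (o : Option G.vertexSet)
    (h : ∀ v, o = some v → G.Inc (e : β) (v : α)) (he : e' ≠ e) :
    (O.update e o h).head e' = O.head e' := by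
  simp [update, he]

open Classical in
theorem indeg_eq_sum [Fintype G.edgeSet] (O : G.PartialOrientation) (v : G.vertexSet) :
    O.indeg v = ∑ e, if O.head e = some v then 1 else 0 := by
  rw [indeg, Nat.card_eq_fintype_card, Fintype.card_subtype]
  simp

open Classical in
theorem indeg_update [Finite G.edgeSet] (O : G.PartialOrientation) (e : G.edgeSet)
    (o : Option G.vertexSet) (h : ∀ v, o = some v → G.Inc (e : β) (v : α)) (x : G.vertexSet) :
    (O.update e o h).indeg x + (if O.head e = some x then 1 else 0) =
      O.indeg x + (if o = some x then 1 else 0) := by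
  have := Fintype.ofFinite G.edgeSet
  rw [indeg_eq_sum, indeg_eq_sum, ← Finset.add_sum_erase _ _ (Finset.mem_univ e),
    ← Finset.add_sum_erase _ _ (Finset.mem_univ e), head_update_self,
    Finset.sum_congr rfl fun e' he' => by
      rw [head_update_of_ne _ _ _ (Finset.ne_of_mem_erase he')]]
  ring

theorem Arc.indeg_pos [Finite G.edgeSet] {O : G.PartialOrientation} {u v : G.vertexSet}
    (h : O.Arc u v) : 0 < O.indeg v := by
  obtain ⟨e, -, he⟩ := h
  have : Nonempty {e : G.edgeSet // O.head e = some v} := ⟨⟨e, he⟩⟩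
  exact Nat.card_pos

theorem exists_head_of_indeg_pos {O : G.PartialOrientation} {v : G.vertexSet}
    (h : 0 < O.indeg v) : ∃ e, O.head e = some v := by
  by_contra! hO
  have : IsEmpty {e : G.edgeSet // O.head e = some v} := ⟨fun e => hO e.1 e.2⟩
  simp [indeg] at h

theorem indeg_pos_of_reflTransGen [Finite G.edgeSet] {O : G.PartialOrientation}
    {u v : G.vertexSet} (h : Relation.ReflTransGen O.Arc u v) (hv : v ≠ u) : 0 < O.indeg v := by
  obtain rfl | ⟨w, -, hw⟩ := Relation.ReflTransGen.cases_tail h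
  · exact absurd rfl hv
  · exact hw.indeg_pos

theorem exists_arc_of_head_eq {O : G.PartialOrientation} {e : G.edgeSet} {v : G.vertexSet}
    (h : O.head e = some v) : ∃ u : G.vertexSet, G.IsLink (e : β) (u : α) (v : α) ∧ O.Arc u v := by
  obtain ⟨u, hu⟩ := O.inc_head e v h
  exact ⟨⟨u, hu.right_mem⟩, hu.symm, e, hu.symm, h⟩

/-- The edge pivot at `w`: an unoriented edge `e` at `w` becomes oriented towards `w`, and an edge
`e'` oriented towards `w` becomes unoriented. No indegree changes. -/
theorem exists_pivot [Finite G.edgeSet] (O : G.PartialOrientation) {e e' : G.edgeSet}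
    {w : G.vertexSet} (he : O.head e = none) (hew : G.Inc (e : β) (w : α))
    (he' : O.head e' = some w) :
    ∃ O' : G.PartialOrientation, O'.indeg = O.indeg ∧ O'.head e = some w ∧ O'.head e' = none ∧
      ∀ u v, O.Arc u v → v ≠ w → O'.Arc u v := by
  have hne : e ≠ e' := by rintro rfl; simp [he] at he'
  have h₁ : ∀ v, some w = some v → G.Inc (e : β) (v : α) := by rintro v ⟨⟩; exact hew
  have h₂ : ∀ v : G.vertexSet, none = some v → G.Inc (e' : β) (v : α) := by simp
  refine ⟨(O.update e (some w) h₁).update e' none h₂, ?_, ?_, head_update_self .., ?_⟩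
  · funext x
    classical
    have i₁ := O.indeg_update e _ h₁ x
    have i₂ := (O.update e (some w) h₁).indeg_update e' _ h₂ x
    rw [head_update_of_ne _ _ _ hne.symm, he'] at i₂
    simp only [he, reduceCtorEq, if_false] at i₁ i₂
    omega
  · rw [head_update_of_ne _ _ _ hne, head_update_self]
  · rintro u v ⟨d, hd, hdv⟩ hvw
    have hd₁ : d ≠ e := by rintro rfl; simp [he] at hdv
    have hd₂ : d ≠ e' := by rintro rfl; exact hvw (by simpa [he'] using hdv.symm)
    exact ⟨d, hd, by rw [head_update_of_ne _ _ _ hd₂, head_update_of_ne _ _ _ hd₁, hdv]⟩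

/-- There is a directed walk of length `n` from `u` to `v`. -/
def HasWalk (O : G.PartialOrientation) : ℕ → G.vertexSet → G.vertexSet → Prop
  | 0, u, v => u = v
  | n + 1, u, v => ∃ w, O.HasWalk n u w ∧ O.Arc w v

theorem exists_hasWalk {O : G.PartialOrientation} {u v : G.vertexSet}
    (h : Relation.ReflTransGen O.Arc u v) : ∃ n, O.HasWalk n u v := by
  induction h with
  | refl => exact ⟨0, rfl⟩
  | tail _ h ih =>
    obtain ⟨n, hn⟩ := ih
    exact ⟨n + 1, _, hn, h⟩

/-- Only arcs into `w` can be lost, so a walk that breaks has an initial segment ending at `w`. -/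
theorem HasWalk.of_arc_imp {O O' : G.PartialOrientation} {u w : G.vertexSet}
    (h : ∀ x y, O.Arc x y → y ≠ w → O'.Arc x y) :
    ∀ {n : ℕ} {v : G.vertexSet}, O.HasWalk n u v → O'.HasWalk n u v ∨ ∃ m ≤ n, O.HasWalk m u w
  | 0, _, hv => Or.inl hv
  | n + 1, v, hv => by
    by_cases hvw : v = w
    · exact Or.inr ⟨n + 1, le_rfl, hvw ▸ hv⟩
    obtain ⟨x, hx, hxv⟩ := hv
    rcases HasWalk.of_arc_imp h hx with hx' | ⟨m, hm, hw⟩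
    · exact Or.inl ⟨x, hx', h x v hxv hvw⟩
    · exact Or.inr ⟨m, hm.trans n.le_succ, hw⟩

open Classical in
/-- If `v` has a directed walk to an end of an unoriented edge, then some partial orientation has
one more edge oriented towards `v` and the same indegrees elsewhere. -/
theorem exists_indeg_eq_add_of_hasWalk [Finite G.edgeSet] {v w : G.vertexSet} (n : ℕ)
    (O : G.PartialOrientation) {e : G.edgeSet} (hvw : O.HasWalk n v w) (he : O.head e = none)
    (hew : G.Inc (e : β) (w : α)) :
    ∃ O' : G.PartialOrientation, ∀ x, O'.indeg x = O.indeg x + if v = x then 1 else 0 := by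
  induction n using Nat.strong_induction_on generalizing O w e with
  | _ n ih =>
  cases n with
  | zero =>
    obtain rfl : v = w := hvw
    have h₁ : ∀ x, some v = some x → G.Inc (e : β) (x : α) := by rintro x ⟨⟩; exact hew
    refine ⟨O.update e (some v) h₁, fun x => ?_⟩
    have := O.indeg_update e _ h₁ x
    simpa [he] using this
  | succ n =>
    obtain ⟨x, hx, e', he'x, he'⟩ := hvw
    obtain ⟨O', hO', -, he'O, harc⟩ := O.exists_pivot he hew he'
    -- Either the walk to `x` survives the pivot and ends at the newly unoriented `e'`, or a shorter
    -- walk already reached `w` in `O`; then the pivot is discarded.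
    rcases hx.of_arc_imp harc with hx' | ⟨m, hm, hmw⟩
    · obtain ⟨O'', h⟩ := ih n n.lt_succ_self O' hx' he'O he'x.inc_left
      exact ⟨O'', fun y => by rw [h, hO']⟩
    · exact ih m (Nat.lt_succ_of_le hm) O hmw he hew

/-! ### Cut reversals and reachable sets. -/

/-- The number of edges with tail `u` and head `v`. -/
noncomputable def arcCount (O : G.PartialOrientation) (u v : G.vertexSet) : ℕ :=
  Nat.card {e : G.edgeSet // G.IsLink (e : β) (u : α) (v : α) ∧ O.head e = some v}

theorem indeg_eq_sum_arcCount [Fintype G.vertexSet] [Finite G.edgeSet]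
    (O : G.PartialOrientation) (v : G.vertexSet) : O.indeg v = ∑ u, O.arcCount u v := by
  unfold indeg arcCount
  rw [← Nat.card_sigma]
  refine Nat.card_congr ⟨fun e => ⟨⟨(O.inc_head _ _ e.2).other,
    (O.inc_head _ _ e.2).isLink_other.right_mem⟩, e.1,
    (O.inc_head _ _ e.2).isLink_other.symm, e.2⟩, fun x => ⟨x.2.1, x.2.2.2⟩, fun e => rfl, ?_⟩
  rintro ⟨⟨u, hu⟩, e, he, hev⟩
  have hi : G.Inc (e : β) (v : α) := he.inc_right
  have : hi.other = u := hi.isLink_other.right_unique he.symm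
  subst this
  rfl

open Classical in
/-- Orient all the edges on the boundary of `R` away from `R`. -/
noncomputable def orientOut (O : G.PartialOrientation) (R : Set G.vertexSet) :
    G.PartialOrientation where
  head e :=
    if h : ∃ v, v ∉ R ∧ ∃ u ∈ R, G.IsLink (e : β) (u : α) (v : α) then some h.choose
    else O.head e
  inc_head e v hv := by
    split_ifs at hv with h
    · obtain ⟨-, u, -, hu⟩ := h.choose_spec
      cases hv
      exact hu.inc_right
    · exact O.inc_head e v hv

theorem head_orientOut_of_isLink (O : G.PartialOrientation) {R : Set G.vertexSet}
    {e : G.edgeSet} {u v : G.vertexSet} (h : G.IsLink (e : β) (u : α) (v : α)) (hu : u ∈ R)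
    (hv : v ∉ R) : (O.orientOut R).head e = some v := by
  have hex : ∃ v, v ∉ R ∧ ∃ u ∈ R, G.IsLink (e : β) (u : α) (v : α) := ⟨v, hv, u, hu, h⟩
  obtain ⟨hv', u', hu', h'⟩ := hex.choose_spec
  simp only [orientOut, dif_pos hex, Option.some.injEq]
  rcases h.eq_and_eq_or_eq_and_eq h' with ⟨-, h⟩ | ⟨h, -⟩
  · exact (Subtype.ext h).symm
  · exact absurd (Subtype.ext h ▸ hu) hv'

theorem head_orientOut_of_mem_iff (O : G.PartialOrientation) {R : Set G.vertexSet}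
    {e : G.edgeSet} {u v : G.vertexSet} (h : G.IsLink (e : β) (u : α) (v : α))
    (huv : u ∈ R ↔ v ∈ R) : (O.orientOut R).head e = O.head e := by
  have hex : ¬ ∃ v, v ∉ R ∧ ∃ u ∈ R, G.IsLink (e : β) (u : α) (v : α) := by
    rintro ⟨v', hv', u', hu', h'⟩
    rcases h.eq_and_eq_or_eq_and_eq h' with ⟨h₁, h₂⟩ | ⟨h₁, h₂⟩
    · exact hv' (Subtype.ext h₂ ▸ huv.1 (Subtype.ext h₁ ▸ hu'))
    · exact hv' (Subtype.ext h₁ ▸ huv.2 (Subtype.ext h₂ ▸ hu'))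
  simp only [orientOut, dif_neg hex]

/-- The vertices that are reached from `r` by a directed path. -/
def reachable (O : G.PartialOrientation) (r : G.vertexSet) : Set G.vertexSet :=
  {x | Relation.ReflTransGen O.Arc r x}

theorem mem_reachable_self (O : G.PartialOrientation) (r : G.vertexSet) : r ∈ O.reachable r :=
  Relation.ReflTransGen.refl

theorem mem_reachable_of_arc {O : G.PartialOrientation} {r u v : G.vertexSet}
    (hu : u ∈ O.reachable r) (h : O.Arc u v) : v ∈ O.reachable r :=
  Relation.ReflTransGen.tail hu h

theorem reachable_subset_of_arc_imp {O O' : G.PartialOrientation} {r : G.vertexSet}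
    (h : ∀ u v, u ∈ O.reachable r → O.Arc u v → O'.Arc u v) :
    O.reachable r ⊆ O'.reachable r := by
  intro x hx
  induction hx with
  | refl => exact O'.mem_reachable_self r
  | tail hu huv ih => exact mem_reachable_of_arc ih (h _ _ hu huv)

section CutReversal

variable {O : G.PartialOrientation} {r : G.vertexSet}

theorem head_eq_of_isLink_boundary
    (hO : ∀ (e : G.edgeSet) (u v : G.vertexSet), G.IsLink (e : β) (u : α) (v : α) →
      u ∈ O.reachable r → v ∉ O.reachable r → O.head e ≠ none)
    {e : G.edgeSet} {u v : G.vertexSet} (h : G.IsLink (e : β) (u : α) (v : α))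
    (hu : u ∈ O.reachable r) (hv : v ∉ O.reachable r) : O.head e = some u := by
  obtain ⟨w, hw⟩ := Option.ne_none_iff_exists'.1 (hO e u v h hu hv)
  rcases (O.inc_head e w hw).eq_or_eq_of_isLink h with h' | h'
  · rw [hw, Subtype.ext h']
  · exact absurd (mem_reachable_of_arc hu ⟨e, h, Subtype.ext h' ▸ hw⟩) hv

open Classical in
/-- Reversing the boundary of a reachable set fires that set. -/
theorem linearlyEquivalent_orientOut_reachable [G.Loopless] [Fintype G.vertexSet]
    [Finite G.edgeSet]
    (hO : ∀ (e : G.edgeSet) (u v : G.vertexSet), G.IsLink (e : β) (u : α) (v : α) →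
      u ∈ O.reachable r → v ∉ O.reachable r → O.head e ≠ none) :
    G.LinearlyEquivalent O.divisor (O.orientOut (O.reachable r)).divisor := by
  refine ⟨fun x => if x ∈ O.reachable r then 1 else 0, ?_⟩
  funext v
  rw [laplacian_mulVec_apply]
  simp only [divisor, Pi.sub_apply, sub_sub_sub_cancel_right, indeg_eq_sum_arcCount, Nat.cast_sum,
    ← Finset.sum_sub_distrib]
  refine Finset.sum_congr rfl fun u _ => ?_
  -- Only boundary edges change head: all pointed into the reachable set, and all point out
  -- afterwards.
  by_cases hu : u ∈ O.reachable r <;> by_cases hv : v ∈ O.reachable r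
  · have : (O.orientOut (O.reachable r)).arcCount u v = O.arcCount u v :=
      Nat.card_congr (Equiv.subtypeEquivRight fun e => and_congr_right fun he => by
        rw [head_orientOut_of_mem_iff O he (iff_of_true hu hv)])
    simp [hu, hv, this]
  · have h₁ : (O.orientOut (O.reachable r)).arcCount u v = G.edgeCount u v :=
      Nat.card_congr (Equiv.subtypeEquivRight fun e => and_iff_left_of_imp fun he => by
        rw [head_orientOut_of_isLink O he hu hv])
    have h₂ : O.arcCount u v = 0 := by
      have : IsEmpty {e : G.edgeSet // G.IsLink (e : β) (u : α) (v : α) ∧ O.head e = some v} :=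
        ⟨fun e => hv (mem_reachable_of_arc hu ⟨e.1, e.2⟩)⟩
      exact Nat.card_of_isEmpty
    simp [hu, hv, h₁, h₂]
  · have h₁ : (O.orientOut (O.reachable r)).arcCount u v = 0 := by
      have : IsEmpty {e : G.edgeSet // G.IsLink (e : β) (u : α) (v : α) ∧
          (O.orientOut (O.reachable r)).head e = some v} := by
        refine ⟨fun ⟨e, he, hev⟩ => hu ?_⟩
        rw [head_orientOut_of_isLink O he.symm hv hu, Option.some.injEq] at hev
        exact hev ▸ hv
      exact Nat.card_of_isEmpty
    have h₂ : O.arcCount u v = G.edgeCount u v :=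
      Nat.card_congr (Equiv.subtypeEquivRight fun e => and_iff_left_of_imp fun he =>
        head_eq_of_isLink_boundary hO he.symm hv hu)
    simp [hu, hv, h₁, h₂]
  · have : (O.orientOut (O.reachable r)).arcCount u v = O.arcCount u v :=
      Nat.card_congr (Equiv.subtypeEquivRight fun e => and_congr_right fun he => by
        rw [head_orientOut_of_mem_iff O he (iff_of_false hu hv)])
    simp [hu, hv, this]

/-- If some vertex is not reached from `r`, and no boundary edge of the reached set is unoriented,
then a cut reversal lets `r` reach more vertices, and keeps positive indegrees positive away
from `r`. -/
theorem exists_reachable_ssubset [G.Loopless] [Fintype G.vertexSet] [Finite G.edgeSet]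
    (hG : G.IsConnectedGraph) {x : G.vertexSet} (hx : x ∉ O.reachable r)
    (hO : ∀ (e : G.edgeSet) (u v : G.vertexSet), G.IsLink (e : β) (u : α) (v : α) →
      u ∈ O.reachable r → v ∉ O.reachable r → O.head e ≠ none) :
    ∃ O' : G.PartialOrientation, G.LinearlyEquivalent O.divisor O'.divisor ∧
      O.reachable r ⊂ O'.reachable r ∧ ∀ y, y ≠ r → 0 < O.indeg y → 0 < O'.indeg y := by
  set O' := O.orientOut (O.reachable r) with hO'
  have hsub : O.reachable r ⊆ O'.reachable r := by
    refine reachable_subset_of_arc_imp fun u v hu huv => ?_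
    have hv := mem_reachable_of_arc hu huv
    obtain ⟨e, he, hev⟩ := huv
    exact ⟨e, he, by rw [hO', head_orientOut_of_mem_iff O he (iff_of_true hu hv), hev]⟩
  refine ⟨O', linearlyEquivalent_orientOut_reachable hO, ?_, fun y hy hpos => ?_⟩
  · obtain ⟨e, u, v, he, hu, hv⟩ :=
      hG.exists_isLink_of_mem_of_notMem (O.mem_reachable_self r) hx
    refine Set.ssubset_iff_exists.2 ⟨hsub, v, ?_, hv⟩
    exact mem_reachable_of_arc (hsub hu) ⟨e, he, head_orientOut_of_isLink O he hu hv⟩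
  -- A reached `y ≠ r` is still reached. For an unreached `y`, the tail of an incoming edge is also
  -- unreached, so that edge is not reversed.
  · by_cases hyR : y ∈ O.reachable r
    · exact indeg_pos_of_reflTransGen (hsub hyR) hy
    · obtain ⟨e, he⟩ := exists_head_of_indeg_pos hpos
      obtain ⟨u, hu, huy⟩ := exists_arc_of_head_eq he
      have huR : u ∉ O.reachable r := fun h => hyR (mem_reachable_of_arc h huy)
      refine Arc.indeg_pos (u := u) ⟨e, hu, ?_⟩
      rw [hO', head_orientOut_of_mem_iff O hu (iff_of_false huR hyR), he]

end CutReversal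

/-! ### Realizing effective divisors and connecting to `q`. -/

theorem divDegree_divisor [Fintype G.vertexSet] (O : G.PartialOrientation) :
    G.divDegree O.divisor = (∑ v, O.indeg v : ℕ) - (Nat.card G.vertexSet : ℤ) := by
  simp [divDegree, divisor, Finset.sum_sub_distrib]

theorem exists_head_eq_none [Fintype G.vertexSet] [Finite G.edgeSet] (O : G.PartialOrientation)
    (h : G.divDegree O.divisor + Nat.card G.vertexSet < Nat.card G.edgeSet) :
    ∃ e, O.head e = none := by
  by_contra! hO
  rw [divDegree_divisor, sub_add_cancel, Nat.cast_lt] at h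
  refine h.ne ?_
  unfold indeg
  rw [← Nat.card_sigma]
  refine Nat.card_congr (Equiv.ofBijective (fun x => x.2.1) ⟨?_, fun e => ?_⟩)
  · rintro ⟨v, e, he⟩ ⟨v', e', he'⟩ (rfl : e = e')
    obtain rfl : v = v' := Option.some_injective _ (he.symm.trans he')
    rfl
  · obtain ⟨v, hv⟩ := Option.ne_none_iff_exists'.1 (hO e)
    exact ⟨⟨v, e, hv⟩, rfl⟩

/-- If an unoriented edge meets the set reached from `v`, pivots carry it back to `v`. Otherwise a
cut reversal enlarges that set; the degree bound guarantees an unoriented edge, which must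
eventually be met. -/
theorem exists_linearlyEquivalent_divisor_add_chip [G.Loopless] [Fintype G.vertexSet]
    [Finite G.edgeSet] (hG : G.IsConnectedGraph) (v : G.vertexSet) (O : G.PartialOrientation)
    (h : G.divDegree O.divisor + Nat.card G.vertexSet < Nat.card G.edgeSet) :
    ∃ O' : G.PartialOrientation, G.LinearlyEquivalent (O.divisor + G.chip v) O'.divisor ∧
      0 < O'.indeg v ∧ ∀ x, 0 < O.indeg x → 0 < O'.indeg x := by
  classical
  induction hR : O.reachable v using WellFoundedGT.induction generalizing O with
  | _ R ih =>
  subst hR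
  by_cases hw : ∃ w ∈ O.reachable v, ∃ e, O.head e = none ∧ G.Inc (e : β) (w : α)
  · obtain ⟨w, hvw, e, he, hew⟩ := hw
    obtain ⟨n, hn⟩ := exists_hasWalk hvw
    obtain ⟨O', hO'⟩ := exists_indeg_eq_add_of_hasWalk n O hn he hew
    refine ⟨O', ?_, by simp [hO'], fun x hx => by rw [hO']; omega⟩
    convert LinearlyEquivalent.refl (G := G) _
    funext x
    simp only [divisor, chip, hO', Pi.add_apply, Pi.single_apply, eq_comm (a := x)]
    push_cast
    ring
  · push Not at hw
    obtain ⟨e, he⟩ := O.exists_head_eq_none h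
    obtain ⟨a, b, hab⟩ := exists_isLink_of_mem_edgeSet e.2
    obtain ⟨O', hO', hlt, hpos⟩ := exists_reachable_ssubset (O := O) (r := v) hG
      (x := ⟨a, hab.left_mem⟩) (fun ha => hw _ ha e he hab.inc_left)
      (fun e u v he hu _ h => hw u hu e h he.inc_left)
    obtain ⟨O'', h₁, h₂, h₃⟩ := ih _ hlt O' (hO'.divDegree_eq ▸ h) rfl
    refine ⟨O'', (hO'.add_right _).trans h₁, h₂, fun x hx => ?_⟩
    -- The reversals may destroy the positive indegree of `v`, but the final new edge restores it.
    by_cases hxv : x = v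
    · exact hxv ▸ h₂
    · exact h₃ x (hpos x hxv hx)

/-- Every effective divisor `F` of degree at most the number of edges is, up to linear
equivalence, the indegree sequence of a partial orientation with positive indegrees on the
support of `F`. -/
theorem exists_linearlyEquivalent_divisor_of_nonneg [G.Loopless] [Fintype G.vertexSet]
    [Finite G.edgeSet] (hG : G.IsConnectedGraph) (n : ℕ) (F : G.Divisor) (hF : 0 ≤ F)
    (hn : G.divDegree F = n) (hle : n ≤ Nat.card G.edgeSet) :
    ∃ O : G.PartialOrientation, G.LinearlyEquivalent (F - 1) O.divisor ∧
      ∀ x, 0 < F x → 0 < O.indeg x := by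
  classical
  induction n generalizing F with
  | zero =>
    obtain rfl : F = 0 := by
      funext v
      exact (Finset.sum_eq_zero_iff_of_nonneg fun v _ => hF v).1
        (by simpa [divDegree] using hn) v (Finset.mem_univ v)
    refine ⟨⟨fun _ => none, by simp⟩, ?_, by simp⟩
    convert LinearlyEquivalent.refl (G := G) _
    funext x
    simp [divisor, indeg]
  | succ n ih =>
    obtain ⟨v, hv⟩ : ∃ v, 0 < F v := by
      by_contra! h
      have : G.divDegree F ≤ 0 := Finset.sum_nonpos fun v _ => h v
      omega
    have hF' : F - G.chip v + G.chip v = F := sub_add_cancel _ _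
    have hd := divDegree_add (F - G.chip v) (G.chip v)
    rw [hF', divDegree_chip] at hd
    obtain ⟨O, hO, hpos⟩ := ih (F - G.chip v) (fun x => by
      by_cases hx : x = v
      · subst hx; simp [chip]; omega
      · simpa [chip, hx] using hF x) (by push_cast at hn; omega) (by omega)
    have hone : G.divDegree (1 : G.Divisor) = Nat.card G.vertexSet := by simp [divDegree]
    have hd₁ := divDegree_add (F - G.chip v - 1) 1
    rw [sub_add_cancel, hone, hO.divDegree_eq] at hd₁
    obtain ⟨O', hO', hv', hpos'⟩ := exists_linearlyEquivalent_divisor_add_chip hG v O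
      (by push_cast at hn; omega)
    refine ⟨O', ?_, fun x hx => ?_⟩
    · have := (hO.add_right (G.chip v)).trans hO'
      rwa [show F - G.chip v - 1 + G.chip v = F - 1 by abel] at this
    · by_cases hxv : x = v
      · exact hxv ▸ hv'
      · exact hpos' x (hpos x (by simpa [chip, hxv] using hx))

/-- If the boundary of the set reached from `q` is fully oriented, reverse it. Otherwise pivot an
unoriented boundary edge towards its unreached end, which has an incoming edge to release by `hpos`.
Both moves enlarge the set and preserve `hpos`. -/
theorem exists_isQConnected_linearlyEquivalent [G.Loopless] [Fintype G.vertexSet]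
    [Finite G.edgeSet] (hG : G.IsConnectedGraph) (q : G.vertexSet) (O : G.PartialOrientation)
    (hpos : ∀ x, x ≠ q → 0 < O.indeg x) :
    ∃ O' : G.PartialOrientation, O'.IsQConnected q ∧
      G.LinearlyEquivalent O.divisor O'.divisor := by
  induction hR : O.reachable q using WellFoundedGT.induction generalizing O with
  | _ R ih =>
  subst hR
  by_cases hq : ∀ x, x ∈ O.reachable q
  · exact ⟨O, hq, LinearlyEquivalent.refl _⟩
  push Not at hq
  obtain ⟨x, hx⟩ := hq
  by_cases hO : ∀ (e : G.edgeSet) (u v : G.vertexSet), G.IsLink (e : β) (u : α) (v : α) →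
      u ∈ O.reachable q → v ∉ O.reachable q → O.head e ≠ none
  · obtain ⟨O', hO', hlt, hpos'⟩ := exists_reachable_ssubset hG hx hO
    obtain ⟨O'', h₁, h₂⟩ := ih _ hlt O' (fun y hy => hpos' y hy (hpos y hy)) rfl
    exact ⟨O'', h₁, hO'.trans h₂⟩
  · push Not at hO
    obtain ⟨e, u, v, he, hu, hv, hnone⟩ := hO
    have hvq : v ≠ q := by rintro rfl; exact hv (O.mem_reachable_self v)
    obtain ⟨e', he'⟩ := exists_head_of_indeg_pos (hpos v hvq)
    obtain ⟨O', hO', heO, -, harc⟩ := O.exists_pivot hnone he.inc_right he'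
    have hsub : O.reachable q ⊆ O'.reachable q :=
      reachable_subset_of_arc_imp fun a b ha hab => harc a b hab (by
        rintro rfl; exact hv (mem_reachable_of_arc ha hab))
    have hlt : O.reachable q ⊂ O'.reachable q :=
      Set.ssubset_iff_exists.2 ⟨hsub, v, mem_reachable_of_arc (hsub hu) ⟨e, he, heO⟩, hv⟩
    obtain ⟨O'', h₁, h₂⟩ := ih _ hlt O' (fun y hy => by rw [hO']; exact hpos y hy) rfl
    refine ⟨O'', h₁, ?_⟩
    have hdiv : O'.divisor = O.divisor := by funext y; simp [divisor, hO']
    exact hdiv ▸ h₂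

end PartialOrientation

end Graph

theorem theorem5 {α β : Type*} (G : Graph α β) [G.Loopless]
    [Fintype G.vertexSet] [Finite G.edgeSet] (hG : G.IsConnectedGraph)
    (q : G.vertexSet) (D : G.Divisor) (hD : G.divDegree D ≤ G.genus - 1) :
    (∃ O : G.PartialOrientation, O.IsQConnected q ∧ G.LinearlyEquivalent D O.divisor) ↔
      0 ≤ G.divRank (D + G.chip q) := by
  classical
  rw [Graph.divRank_nonneg_iff q]
  constructor
  · rintro ⟨O, hO, hDO⟩
    refine ⟨O.divisor + G.chip q, fun v => ?_, hDO.add_right _⟩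
    by_cases hv : v = q
    · subst hv
      simp [Graph.PartialOrientation.divisor, Graph.chip]
    · have := Graph.PartialOrientation.indeg_pos_of_reflTransGen (hO v) hv
      simp [Graph.PartialOrientation.divisor, Graph.chip, hv]
      omega
  · rintro ⟨E, hE, hDE⟩
    have hE' : G.LinearlyEquivalent D (E - G.chip q) := by
      have := hDE.add_right (-G.chip q)
      rwa [add_neg_cancel_right, ← sub_eq_add_neg] at this
    have hpos : ∀ x, x ≠ q → 0 < (E - G.chip q + 1) x := fun x hx => by
      have := hE x
      simp only [Pi.zero_apply] at this
      simp [Graph.chip, hx]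
      omega
    have hF : 0 ≤ E - G.chip q + 1 := fun x => by
      by_cases hx : x = q
      · subst hx
        simpa [Graph.chip] using hE x
      · exact (hpos x hx).le
    have hone : G.divDegree (1 : G.Divisor) = Nat.card G.vertexSet := by simp [Graph.divDegree]
    -- This is where `deg D ≤ g - 1 = |E(G)| - |V(G)|` enters.
    have hdeg : G.divDegree (E - G.chip q + 1) ≤ Nat.card G.edgeSet := by
      rw [Graph.divDegree_add, ← hE'.divDegree_eq, hone]
      rw [Graph.genus] at hD
      omega
    obtain ⟨n, hn⟩ := Int.eq_ofNat_of_zero_le (Finset.sum_nonneg fun v _ => hF v :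
      0 ≤ G.divDegree (E - G.chip q + 1))
    obtain ⟨O, hO, hOpos⟩ :=
      Graph.PartialOrientation.exists_linearlyEquivalent_divisor_of_nonneg hG n _ hF hn
        (Nat.cast_le.1 (hn.symm.trans_le hdeg))
    obtain ⟨O', hq, hO'⟩ := O.exists_isQConnected_linearlyEquivalent hG q
      fun x hx => hOpos x (hpos x hx)
    rw [add_sub_cancel_right] at hO
    exact ⟨O', hq, (hE'.trans hO).trans hO'⟩
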